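/- Let $k$ be an algebraically closed field. For a finite-dimensional $k$-algebra $\Lambda$ let $\mathrm{mod}\,\Lambda$ be the category of finitely generated left $\Lambda$-modules. An ideal $\mathfrak I$ of a skeletally small additive category $\mathcal C$ is a class of morphisms that contains all zero morphisms and is closed under addition and under composition with arbitrary morphisms on both sides; $\mathfrak I(X,Y)$ denotes the set of morphisms $X\to Y$ in $\mathfrak I$. Define transfinite powers as follows: $\mathfrak I^0$ is the ideal of all morphisms; for a natural number $n\ge 1$, $\mathfrak I^n$ is the ideal generated by all compositions of $n$-tuples of morphisms from $\mathfrak I$ (so $\mathfrak I^1=\mathfrak I$); $\mathfrak I^\alpha=\bigcap_{\beta<\alpha}\mathfrak I^\beta$ for a limit ordinal $\alpha$; and $\mathfrak I^{\beta+n}=(\mathfrak I^\beta)^{n+1}$ for a limit ordinal $\beta$ and a natural number $n\ge 1$. Put $\mathfrak I^*=\bigcap_\alpha \mathfrak I^\alpha$, the intersection over all ordinals $\alpha$. The radical $\mathrm{rad}_\Lambda$ is the ideal of $\mathrm{mod}\,\Lambda$ generated by all non-invertible morphisms between indecomposable modules, and $\mathrm{rad}_\Lambda^*=(\mathrm{rad}_\Lambda)^*$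 is the transfinite radical. For finite-dimensional $k$-algebras $\Gamma,\Lambda$, an additive functor $F:\mathrm{mod}\,\Gamma\to\mathrm{mod}\,\Lambda$ is called a representation embedding if it is faithful and exact, preserves indecomposability, and reflects isomorphism classes (if $FX\cong FY$ then $X\cong Y$). A finite-dimensional $k$-algebra $\Lambda$ is called wild if for every finite-dimensional $k$-algebra $\Gamma$ there is a representation embedding $\mathrm{mod}\,\Gamma\to\mathrm{mod}\,\Lambda$. **Proposition.** Let $\Lambda$ be a wild finite-dimensional algebra over an algebraically closed field $k$. Then $\mathrm{rad}_\Lambda^*\neq 0$. Moreover, there exists an indecomposable $\Lambda$-module $X$ in $\mathrm{mod}\,\Lambda$ such that $0\neq \mathrm{rad}_\Lambda^*(X,X)\subseteq \mathrm{End}_\Lambda(X)$. -/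

import Mathlib

open CategoryTheory CategoryTheory.Limits

universe v u

/-! ### Ideals of a preadditive category -/

/-- A two-sided ideal of a preadditive category: a class of morphisms which contains the zero
morphisms and is closed under addition (hence, by composing with `-𝟙`, under negation) and under
composition with arbitrary morphisms on both sides. `I.hom X Y` is the set of morphisms `X ⟶ Y`
in the ideal `I`, as a subgroup. -/
@[ext]
structure MorphismIdeal (C : Type u) [Category.{v} C] [Preadditive C] where
  hom : ∀ X Y : C, AddSubgroup (X ⟶ Y)
  comp_left : ∀ {W X Y : C} (g : W ⟶ X) {f : X ⟶ Y}, f ∈ hom X Y → g ≫ f ∈ hom W Y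
  comp_right : ∀ {X Y Z : C} {f : X ⟶ Y} (g : Y ⟶ Z), f ∈ hom X Y → f ≫ g ∈ hom X Z

namespace MorphismIdeal

variable {C : Type u} [Category.{v} C] [Preadditive C]

/-- The zero ideal. -/
instance : Bot (MorphismIdeal C) where
  bot :=
    { hom := fun _ _ => ⊥
      comp_left := by
        intro W X Y g f hf
        rw [AddSubgroup.mem_bot] at hf ⊢
        rw [hf, comp_zero]
      comp_right := by
        intro X Y Z f g hf
        rw [AddSubgroup.mem_bot] at hf ⊢
        rw [hf, zero_comp] }

/-- The ideal of all morphisms. -/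
instance : Top (MorphismIdeal C) where
  top :=
    { hom := fun _ _ => ⊤
      comp_left := fun _ _ _ => AddSubgroup.mem_top _
      comp_right := fun _ _ => AddSubgroup.mem_top _ }

/-- Intersection of a family of ideals. -/
instance : InfSet (MorphismIdeal C) where
  sInf S :=
    { hom := fun X Y => ⨅ I ∈ S, I.hom X Y
      comp_left := by
        intro W X Y g f hf
        simp only [AddSubgroup.mem_iInf] at hf ⊢
        exact fun I hI => I.comp_left g (hf I hI)
      comp_right := by
        intro X Y Z f g hf
        simp only [AddSubgroup.mem_iInf] at hf ⊢
        exact fun I hI => I.comp_right g (hf I hI) }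

theorem mem_sInf {S : Set (MorphismIdeal C)} {X Y : C} {f : X ⟶ Y} :
    f ∈ (sInf S).hom X Y ↔ ∀ I ∈ S, f ∈ I.hom X Y := by
  change f ∈ (⨅ I ∈ S, I.hom X Y) ↔ _
  simp only [AddSubgroup.mem_iInf]

theorem mem_iInf {ι : Sort*} {I : ι → MorphismIdeal C} {X Y : C} {f : X ⟶ Y} :
    f ∈ (⨅ i, I i).hom X Y ↔ ∀ i, f ∈ (I i).hom X Y := by
  rw [iInf, mem_sInf]
  simp only [Set.forall_mem_range]

/-- The ideal generated by a class of morphisms: the smallest ideal containing it. -/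
def generatedBy (S : MorphismProperty C) : MorphismIdeal C :=
  sInf {I | ∀ ⦃X Y : C⦄ (f : X ⟶ Y), S f → f ∈ I.hom X Y}

/-- `I.IsComposite n f` says that `f` is a composition of an `n`-tuple (`n ≥ 1`) of composable
morphisms from `I`. -/
inductive IsComposite (I : MorphismIdeal C) : ℕ → ∀ ⦃X Y : C⦄, (X ⟶ Y) → Prop
  | single {X Y : C} (f : X ⟶ Y) (hf : f ∈ I.hom X Y) : IsComposite I 1 f
  | comp {n : ℕ} {X Y Z : C} (f : X ⟶ Y) (g : Y ⟶ Z) (hf : IsComposite I n f)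
      (hg : g ∈ I.hom Y Z) : IsComposite I (n + 1) (f ≫ g)

/-- Finite powers: `I ^ 0` consists of all morphisms, and for `n ≥ 1` the power `I ^ n` is the
ideal generated by the compositions of `n`-tuples of morphisms from `I`. -/
def npow (I : MorphismIdeal C) : ℕ → MorphismIdeal C
  | 0 => ⊤
  | n + 1 => generatedBy (fun _ _ f => I.IsComposite (n + 1) f)

theorem npow_zero (I : MorphismIdeal C) : I.npow 0 = ⊤ := rfl

theorem npow_one (I : MorphismIdeal C) : I.npow 1 = I := by
  ext X Y f
  change f ∈ (sInf _ : MorphismIdeal C).hom X Y ↔ _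
  rw [mem_sInf]
  constructor
  · intro h
    refine h I ?_
    intro X Y f hf
    cases hf with
    | single _ hf => exact hf
    | comp f g hf hg => exact I.comp_left f hg
  · intro hf J hJ
    exact hJ f (IsComposite.single f hf)

open Classical in
/-- Transfinite powers of an ideal. For finite `α` this is the finite power; for a limit
ordinal `α` it is the intersection of the earlier powers; and for `α = β + n` with `β` a limit
ordinal and `n ≥ 1` it is the `(n + 1)`-st power of `I ^ β`. Here `β = ω * (α / ω)` and
`n = α % ω`, see `pow_natCast`, `pow_limit` and `pow_limit_add` below. -/
noncomputable def pow (I : MorphismIdeal C) (α : Ordinal.{max u v}) : MorphismIdeal C :=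
  if α < Ordinal.omega0 then I.npow (Cardinal.toNat α.card)
  else if _h : α % Ordinal.omega0 = 0 then ⨅ β : Set.Iio α, pow I β.1
  else (pow I (Ordinal.omega0 * (α / Ordinal.omega0))).npow
    (Cardinal.toNat (α % Ordinal.omega0).card + 1)
termination_by α
decreasing_by
  · exact β.2
  · refine lt_of_le_of_ne (Ordinal.mul_div_le α Ordinal.omega0) fun h => _h ?_
    have h2 := Ordinal.div_add_mod α Ordinal.omega0
    rw [h] at h2
    simpa using h2

theorem pow_natCast (I : MorphismIdeal C) (n : ℕ) : I.pow n = I.npow n := by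
  rw [pow, if_pos (Ordinal.natCast_lt_omega0 n)]
  simp

theorem pow_zero (I : MorphismIdeal C) : I.pow 0 = ⊤ := by
  simpa [npow_zero] using I.pow_natCast 0

theorem pow_one (I : MorphismIdeal C) : I.pow 1 = I := by
  simpa [npow_one] using I.pow_natCast 1

theorem pow_limit (I : MorphismIdeal C) {α : Ordinal.{max u v}} (hα : Order.IsSuccLimit α) :
    I.pow α = ⨅ β : Set.Iio α, I.pow β.1 := by
  have h1 : ¬ α < Ordinal.omega0 := not_lt.2 (Ordinal.omega0_le_of_isSuccLimit hα)
  have h2 : α % Ordinal.omega0 = 0 :=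
    Ordinal.mod_eq_zero_of_dvd (Ordinal.isSuccPrelimit_iff_omega0_dvd.1 hα.isSuccPrelimit)
  rw [pow, if_neg h1, dif_pos h2]

theorem pow_limit_add (I : MorphismIdeal C) {β : Ordinal.{max u v}} (hβ : Order.IsSuccLimit β)
    {n : ℕ} (hn : 1 ≤ n) : I.pow (β + n) = (I.pow β).npow (n + 1) := by
  have h1 : ¬ β + n < Ordinal.omega0 :=
    not_lt.2 ((Ordinal.omega0_le_of_isSuccLimit hβ).trans le_self_add)
  obtain ⟨γ, rfl⟩ := Ordinal.isSuccPrelimit_iff_omega0_dvd.1 hβ.isSuccPrelimit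
  have h2 : (Ordinal.omega0 * γ + n) % Ordinal.omega0 = n := by
    rw [Ordinal.mul_add_mod_self, Ordinal.mod_eq_of_lt (Ordinal.natCast_lt_omega0 n)]
  have h3 : (Ordinal.omega0 * γ + n) / Ordinal.omega0 = γ := by
    rw [Ordinal.mul_add_div _ Ordinal.omega0_ne_zero,
      Ordinal.div_eq_zero_of_lt (Ordinal.natCast_lt_omega0 n), add_zero]
  have h4 : (n : Ordinal.{max u v}) ≠ 0 := by exact_mod_cast (by omega : n ≠ 0)
  rw [pow, if_neg h1, dif_neg (by rw [h2]; exact h4), h2, h3]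
  simp

/-- `I ^ *`, the intersection of all transfinite powers of `I`. (All morphisms of `C` form a
type in universe `max u v`, so ordinals of that universe suffice for the decreasing chain
to become stationary.) -/
noncomputable def star (I : MorphismIdeal C) : MorphismIdeal C :=
  ⨅ α : Ordinal.{max u v}, I.pow α

end MorphismIdeal

/-! ### The radical and the transfinite radical -/

section Radical

variable (C : Type u) [Category.{v} C] [Preadditive C] [HasBinaryBiproducts C]

/-- The radical: the ideal generated by the non-invertible morphisms between indecomposable
objects. (`Indecomposable` objects are non-zero.) -/
def categoryRadical : MorphismIdeal C :=
  MorphismIdeal.generatedBy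
    (fun X Y f => Indecomposable X ∧ Indecomposable Y ∧ ¬ IsIso f)

/-- The transfinite radical. -/
noncomputable def transfiniteRadical : MorphismIdeal C :=
  (categoryRadical C).star

end Radical

/-! ### Finitely generated modules, representation embeddings, wild algebras -/

/-- The direct sum of two finitely generated modules is finitely generated. -/
instance FGModuleCat.instHasBinaryBiproducts (R : Type u) [Ring R] :
    HasBinaryBiproducts (FGModuleCat.{v} R) where
  has_binary_biproduct X Y := HasBinaryBiproduct.mk
    { bicone :=
        { pt := FGModuleCat.of R (X × Y)
          fst := FGModuleCat.ofHom (LinearMap.fst R X Y)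
          snd := FGModuleCat.ofHom (LinearMap.snd R X Y)
          inl := FGModuleCat.ofHom (LinearMap.inl R X Y)
          inr := FGModuleCat.ofHom (LinearMap.inr R X Y)
          inl_fst := by ext x; rfl
          inl_snd := by ext x; rfl
          inr_fst := by ext x; rfl
          inr_snd := by ext x; rfl }
      isBilimit := isBinaryBilimitOfTotal _ (FGModuleCat.hom_ext (LinearMap.ext
        fun x : X × Y => Prod.ext (add_zero x.1) (zero_add x.2))) }

/-- A functor between categories of finitely generated modules is a representation embedding
if it is additive, faithful and exact (preserves finite limits and finite colimits), preserves
indecomposability and reflects isomorphism classes. -/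
structure IsRepresentationEmbedding {Γ Λ : Type u} [Ring Γ] [Ring Λ]
    (F : FGModuleCat.{u} Γ ⥤ FGModuleCat.{u} Λ) : Prop where
  additive : F.Additive
  faithful : F.Faithful
  preservesFiniteLimits : PreservesFiniteLimits F
  preservesFiniteColimits : PreservesFiniteColimits F
  indecomposable : ∀ X, Indecomposable X → Indecomposable (F.obj X)
  reflects_iso : ∀ X Y, Nonempty (F.obj X ≅ F.obj Y) → Nonempty (X ≅ Y)

/-- An algebra `Λ` over a field `k` is wild if for every finite-dimensional `k`-algebra `Γ` there
is a representation embedding from finitely generated `Γ`-modules to finitely generated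
`Λ`-modules. -/
def IsWildAlgebra (k Λ : Type u) [Field k] [Ring Λ] [Algebra k Λ] : Prop :=
  ∀ (Γ : Type u) [Ring Γ] [Algebra k Γ] [FiniteDimensional k Γ],
    ∃ F : FGModuleCat.{u} Γ ⥤ FGModuleCat.{u} Λ, IsRepresentationEmbedding F

/-!
The proof exhibits, over a suitable finite-dimensional algebra `Γ`, a class of non-isomorphisms
between indecomposable modules in which every member is the composite of two other members. Such a
class lies in every transfinite power of the radical (`MorphismIdeal.mem_star_of_factors`). A
representation embedding `F : mod Γ ⥤ mod Λ` preserves all of this: it preserves indecomposability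
and composition, and being faithful it reflects monomorphisms and epimorphisms, so that
non-isomorphisms go to non-isomorphisms. Hence the images of these morphisms lie in the transfinite
radical of `Λ`.

The class is a copy of the dense order of finite words in two letters, compared lexicographically
with `false < end < true`. A word `w` of length `n` is turned into a pair of operators `X`, `Y` on a
space with basis `e_0, …, e_n`: the letter `false` between `e_i` and `e_{i+1}` means
`X e_i = e_{i+1}`, the letter `true` means `Y e_{i+1} = e_i`. If `w < v` have the common initial
segment of length `p`, then truncation to `e_0, …, e_p` commutes with the operators
(`wordTrunc_wordUp`, `wordTrunc_wordDown`), and it factors through the truncations for `w < s < v`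
with `s = w ++ [true]` or `s = v ++ [false]` (`WordBranch.exists_between`).

The matrix of an endomorphism commuting with `X` and `Y` has constant diagonal
(`wordSpace_diag_eq`) and is triangular for an order on the basis (`wordSpace_eq_or_rank_lt`), so an idempotent one is `0` or the
identity (`wordSpace_idempotent`). A pair of operators on `V` becomes a module on `V × V` over
`Γ = k[ε₀, ε₁, ε₂] / (ε₀, ε₁, ε₂)²`, the `ε`'s acting as `id`, `X`, `Y` from the first component to
the second; this keeps idempotent endomorphisms trivial (`DoubledModule.idempotent_trivial`).

Finally, any linear map `V → W` induces a `Γ`-linear map from the first component of `V × V` to the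
second component of `W × W`. This gives a way back from the module of `v` to that of `w`, and hence
a non-zero endomorphism in the transfinite radical.
-/

/-! ### Self-factorising classes of morphisms -/

section SelfFactorising

variable {C : Type u} [Category.{v} C] [Preadditive C]

theorem MorphismIdeal.mem_generatedBy {S : MorphismProperty C} {X Y : C} {f : X ⟶ Y} (hf : S f) :
    f ∈ (MorphismIdeal.generatedBy S).hom X Y := by
  rw [MorphismIdeal.generatedBy, MorphismIdeal.mem_sInf]
  exact fun I hI => hI f hf

theorem MorphismIdeal.isComposite_of_factors {S : MorphismProperty C}
    (hS : ∀ ⦃X Y : C⦄ (f : X ⟶ Y), S f → ∃ (Z : C) (g : X ⟶ Z) (h : Z ⟶ Y),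
      S g ∧ S h ∧ f = g ≫ h)
    {I : MorphismIdeal C} (hI : ∀ ⦃X Y : C⦄ (f : X ⟶ Y), S f → f ∈ I.hom X Y) (n : ℕ) :
    ∀ ⦃X Y : C⦄ (f : X ⟶ Y), S f → I.IsComposite (n + 1) f := by
  induction n with
  | zero => exact fun X Y f hf => .single f (hI f hf)
  | succ n ih =>
    intro X Y f hf
    obtain ⟨Z, g, h, hg, hh, rfl⟩ := hS f hf
    exact .comp g h (ih g hg) (hI h hh)

theorem MorphismIdeal.mem_npow_of_factors {S : MorphismProperty C}
    (hS : ∀ ⦃X Y : C⦄ (f : X ⟶ Y), S f → ∃ (Z : C) (g : X ⟶ Z) (h : Z ⟶ Y),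
      S g ∧ S h ∧ f = g ≫ h)
    {I : MorphismIdeal C} (hI : ∀ ⦃X Y : C⦄ (f : X ⟶ Y), S f → f ∈ I.hom X Y) (n : ℕ)
    ⦃X Y : C⦄ (f : X ⟶ Y) (hf : S f) : f ∈ (I.npow n).hom X Y := by
  cases n with
  | zero => exact AddSubgroup.mem_top _
  | succ n => exact mem_generatedBy (isComposite_of_factors hS hI n f hf)

/-- A class of morphisms in which every member is the composite of two members cannot be separated
from an ideal `I` containing it by transfinite powers of `I`. -/
theorem MorphismIdeal.mem_star_of_factors {S : MorphismProperty C}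
    (hS : ∀ ⦃X Y : C⦄ (f : X ⟶ Y), S f → ∃ (Z : C) (g : X ⟶ Z) (h : Z ⟶ Y),
      S g ∧ S h ∧ f = g ≫ h)
    {I : MorphismIdeal C} (hI : ∀ ⦃X Y : C⦄ (f : X ⟶ Y), S f → f ∈ I.hom X Y)
    ⦃X Y : C⦄ (f : X ⟶ Y) (hf : S f) : f ∈ I.star.hom X Y := by
  have key (α : Ordinal.{max u v}) :
      ∀ ⦃X Y : C⦄ (f : X ⟶ Y), S f → f ∈ (I.pow α).hom X Y := by
    induction α using WellFoundedLT.induction with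
    | ind α ih =>
      intro X Y f hf
      rw [MorphismIdeal.pow]
      split_ifs with h1 h2
      · exact mem_npow_of_factors hS hI _ f hf
      · rw [MorphismIdeal.mem_iInf]
        exact fun β => ih β.1 β.2 f hf
      · refine mem_npow_of_factors hS (ih _ ?_) _ f hf
        refine lt_of_le_of_ne (Ordinal.mul_div_le α Ordinal.omega0) fun h => h2 ?_
        have h3 := Ordinal.div_add_mod α Ordinal.omega0
        rw [h] at h3
        simpa using h3
  rw [MorphismIdeal.star, MorphismIdeal.mem_iInf]
  exact fun α => key α f hf

theorem mem_transfiniteRadical_of_factors [HasBinaryBiproducts C] {S : MorphismProperty C}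
    (hS : ∀ ⦃X Y : C⦄ (f : X ⟶ Y), S f → ∃ (Z : C) (g : X ⟶ Z) (h : Z ⟶ Y),
      S g ∧ S h ∧ f = g ≫ h)
    (hrad : ∀ ⦃X Y : C⦄ (f : X ⟶ Y), S f → Indecomposable X ∧ Indecomposable Y ∧ ¬ IsIso f)
    ⦃X Y : C⦄ (f : X ⟶ Y) (hf : S f) : f ∈ (transfiniteRadical C).hom X Y :=
  MorphismIdeal.mem_star_of_factors hS
    (fun _ _ g hg => MorphismIdeal.mem_generatedBy (hrad g hg)) f hf

theorem indecomposable_of_idempotents [HasBinaryBiproducts C] {X : C} (h0 : ¬ IsZero X)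
    (h : ∀ e : X ⟶ X, e ≫ e = e → e = 0 ∨ e = 𝟙 X) : Indecomposable X := by
  refine ⟨h0, fun Y Z i => ?_⟩
  rcases h (i.hom ≫ biprod.fst ≫ biprod.inl ≫ i.inv) (by simp) with he | he
  · left
    rw [IsZero.iff_id_eq_zero]
    have := congrArg (fun t => biprod.inl ≫ i.inv ≫ t ≫ i.hom ≫ biprod.fst) he
    simpa using this
  · right
    rw [IsZero.iff_id_eq_zero]
    have := congrArg (fun t => biprod.inr ≫ i.inv ≫ t ≫ i.hom ≫ biprod.snd) he
    simpa using this.symm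

end SelfFactorising

/-! ### Monomorphisms and epimorphisms of finitely generated modules -/

section FGModule

variable {R : Type u} [Ring R] {M N : FGModuleCat.{u} R}

theorem FGModuleCat.injective_of_mono' (f : M ⟶ N) [Mono f] :
    Function.Injective f.hom.hom := by
  rw [injective_iff_map_eq_zero]
  intro m hm
  have h : FGModuleCat.ofHom (LinearMap.toSpanSingleton R M m) =
      (0 : FGModuleCat.of R R ⟶ M) := by
    rw [← cancel_mono f]
    refine FGModuleCat.hom_ext (LinearMap.ext fun r => ?_)
    change f.hom.hom (r • m) = f.hom.hom 0
    rw [map_smul, hm, smul_zero, map_zero]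
  have h2 : (1 : R) • m = 0 := congrArg (fun g => g.hom.hom (1 : R)) h
  rwa [one_smul] at h2

theorem FGModuleCat.surjective_of_epi' (f : M ⟶ N) [Epi f] :
    Function.Surjective f.hom.hom := by
  have h : FGModuleCat.ofHom (LinearMap.range f.hom.hom).mkQ =
      (0 : N ⟶ FGModuleCat.of R (N ⧸ LinearMap.range f.hom.hom)) := by
    rw [← cancel_epi f]
    refine FGModuleCat.hom_ext (LinearMap.ext fun x => ?_)
    exact (Submodule.Quotient.mk_eq_zero _).2 ⟨x, rfl⟩
  intro y
  have h2 : (LinearMap.range f.hom.hom).mkQ y = 0 := congrArg (fun g => g.hom.hom y) h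
  exact (Submodule.Quotient.mk_eq_zero _).1 h2

end FGModule

/-! ### Word representations of two operators -/

section Words

variable (k : Type u) [Field k]

/-- The space with basis `e_0, …, e_n`, where `n` is the length of the word `w`, realised as the
sequences that vanish beyond `n`. -/
def wordSpace (w : List Bool) : Submodule k (ℕ → k) where
  carrier := {f | ∀ j, w.length < j → f j = 0}
  add_mem' {f g} hf hg j hj := by simp [hf j hj, hg j hj]
  zero_mem' j _ := rfl
  smul_mem' c f hf j hj := by simp [hf j hj]

/-- The operator with `e_i ↦ e_{i+1}` if the `i`-th letter (counted from `0`) is `false`, and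
`e_i ↦ 0` otherwise. -/
def wordUp (w : List Bool) : wordSpace k w →ₗ[k] wordSpace k w where
  toFun f := ⟨fun
      | 0 => 0
      | j + 1 => if w[j]? = some false then f.1 j else 0, by
    rintro (_ | j) hj
    · rfl
    · simp [List.getElem?_eq_none (by omega : w.length ≤ j)]⟩
  map_add' f g := by
    ext (_ | j)
    · simp
    · by_cases h : w[j]? = some false <;> simp [h]
  map_smul' c f := by
    ext (_ | j)
    · simp
    · by_cases h : w[j]? = some false <;> simp [h]

/-- The operator with `e_{i+1} ↦ e_i` if the `i`-th letter (counted from `0`) is `true`, and all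
other basis vectors mapped to `0`. -/
def wordDown (w : List Bool) : wordSpace k w →ₗ[k] wordSpace k w where
  toFun f := ⟨fun j => if w[j]? = some true then f.1 (j + 1) else 0, fun j hj => by
    simp [List.getElem?_eq_none hj.le]⟩
  map_add' f g := by
    ext j
    by_cases h : w[j]? = some true <;> simp [h]
  map_smul' c f := by
    ext j
    by_cases h : w[j]? = some true <;> simp [h]

variable {k}

@[simp] theorem wordUp_zero {w : List Bool} (f : wordSpace k w) : (wordUp k w f).1 0 = 0 := rfl

theorem wordUp_succ {w : List Bool} (f : wordSpace k w) (j : ℕ) :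
    (wordUp k w f).1 (j + 1) = if w[j]? = some false then f.1 j else 0 := rfl

theorem wordDown_apply {w : List Bool} (f : wordSpace k w) (j : ℕ) :
    (wordDown k w f).1 j = if w[j]? = some true then f.1 (j + 1) else 0 := rfl

instance (w : List Bool) : FiniteDimensional k (wordSpace k w) := by
  let g : wordSpace k w →ₗ[k] (Fin (w.length + 1) → k) :=
    { toFun f i := f.1 i
      map_add' _ _ := rfl
      map_smul' _ _ := rfl }
  refine FiniteDimensional.of_injective g fun f f' h => ?_
  ext j
  by_cases hj : w.length < j
  · rw [f.2 j hj, f'.2 j hj]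
  · exact congrFun h ⟨j, by omega⟩

variable (k) in
/-- The basis vector `e_i` of `wordSpace k w`, with the convention `e_i = 0` for `i` beyond the
length of `w`. -/
def wordVec (w : List Bool) (i : ℕ) : wordSpace k w :=
  ⟨fun j => if j = i ∧ i ≤ w.length then 1 else 0, fun j hj => if_neg (by omega)⟩

theorem wordVec_apply (w : List Bool) (i j : ℕ) :
    (wordVec k w i).1 j = if j = i ∧ i ≤ w.length then 1 else 0 := rfl

theorem sum_smul_wordVec {w : List Bool} (f : wordSpace k w) :
    ∑ i ∈ Finset.range (w.length + 1), f.1 i • wordVec k w i = f := by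
  ext j
  simp only [AddSubmonoidClass.coe_finsetSum, SetLike.val_smul, Finset.sum_apply, Pi.smul_apply,
    wordVec_apply, smul_eq_mul]
  by_cases hj : w.length < j
  · rw [f.2 j hj]
    exact Finset.sum_eq_zero fun i _ => by rw [if_neg (by omega), mul_zero]
  · rw [Finset.sum_eq_single j (fun i _ hi => by rw [if_neg (by omega), mul_zero])
      (fun h => absurd (Finset.mem_range.2 (by omega)) h), if_pos (by omega), mul_one]

theorem wordUp_wordVec {w : List Bool} {i : ℕ} (h : w[i]? = some false) :
    wordUp k w (wordVec k w i) = wordVec k w (i + 1) := by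
  have hi : i < w.length := (List.getElem?_eq_some_iff.1 h).1
  ext (_ | j)
  · simp [wordVec_apply]
  · rw [wordUp_succ, wordVec_apply, wordVec_apply]
    by_cases hj : j = i
    · subst hj
      simp [h, hi.le, Nat.succ_le_of_lt hi]
    · simp [hj]

theorem wordDown_wordVec {w : List Bool} {i : ℕ} (h : w[i]? = some true) :
    wordDown k w (wordVec k w (i + 1)) = wordVec k w i := by
  have hi : i < w.length := (List.getElem?_eq_some_iff.1 h).1
  ext j
  rw [wordDown_apply, wordVec_apply, wordVec_apply]
  by_cases hj : j = i
  · subst hj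
    simp [h, hi.le, Nat.succ_le_of_lt hi]
  · simp [hj]

theorem wordDown_wordVec_zero (w : List Bool) : wordDown k w (wordVec k w 0) = 0 := by
  ext j
  simp [wordDown_apply, wordVec_apply]

/-- A number encoding the initial segment of length `i` of `w`, read backwards as a binary
expansion: `true` is the digit `1`, `false` the digit `0`, and the empty word is worth `1 / 2`. So
initial segments are compared lexicographically from their last letter on, with
`false < end < true`. -/
def wordRank (w : List Bool) : ℕ → ℚ
  | 0 => 1 / 2
  | i + 1 => (wordRank w i + if w[i]? = some true then 1 else 0) / 2

theorem wordRank_pos (w : List Bool) (i : ℕ) : 0 < wordRank w i := by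
  induction i with
  | zero => norm_num [wordRank]
  | succ i ih =>
    rw [wordRank]
    split_ifs <;> linarith

theorem wordRank_lt_one (w : List Bool) (i : ℕ) : wordRank w i < 1 := by
  induction i with
  | zero => norm_num [wordRank]
  | succ i ih =>
    rw [wordRank]
    split_ifs <;> linarith

theorem getElem?_bool_cases {w : List Bool} {i : ℕ} (hi : i < w.length) :
    w[i]? = some false ∨ w[i]? = some true := by
  rw [List.getElem?_eq_getElem hi]
  cases w[i] <;> simp

section Endomorphisms

variable {w : List Bool} {φ : wordSpace k w →ₗ[k] wordSpace k w}

/-- The matrix of an endomorphism of a word representation is triangular for the order given by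
`wordRank`: when the letters before `e_i` and `e_j` agree, the entry at `(j, i)` equals the one at
`(j - 1, i - 1)`, and at the first disagreement either the entry vanishes or the ranks compare as
claimed. -/
theorem wordSpace_eq_or_rank_lt (hup : ∀ f, φ (wordUp k w f) = wordUp k w (φ f))
    (hdown : ∀ f, φ (wordDown k w f) = wordDown k w (φ f)) (i j : ℕ) (hi : i ≤ w.length)
    (hj : j ≤ w.length) (h : (φ (wordVec k w i)).1 j ≠ 0) :
    i = j ∨ wordRank w j < wordRank w i := by
  induction i generalizing j with
  | zero =>
    cases j with
    | zero => exact .inl rfl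
    | succ j =>
      right
      rcases getElem?_bool_cases (w := w) (i := j) (by omega) with hw | hw
      · have := wordRank_lt_one w j
        simp only [wordRank, hw]
        norm_num
        linarith
      · have h2 := congrArg (fun f => f.1 j) (hdown (wordVec k w 0))
        simp only [wordDown_wordVec_zero, map_zero, wordDown_apply, hw, if_true] at h2
        exact absurd h2.symm h
  | succ i ih =>
    rcases getElem?_bool_cases (w := w) (i := i) (by omega) with hw | hw
    · rw [← wordUp_wordVec hw, hup] at h
      cases j with
      | zero => exact absurd rfl h
      | succ j =>
        rw [wordUp_succ] at h
        split_ifs at h with hw'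
        · rcases ih j (by omega) (by omega) h with rfl | h3
          · exact .inl rfl
          · right
            simp only [wordRank, hw, hw']
            linarith
        · exact absurd rfl h
    · have hpos := wordRank_pos w i
      cases j with
      | zero =>
        right
        simp only [wordRank, hw, if_true]
        linarith
      | succ j =>
        rcases getElem?_bool_cases (w := w) (i := j) (by omega) with hw' | hw'
        · right
          have := wordRank_lt_one w j
          simp only [wordRank, hw, hw']
          norm_num
          linarith
        · have h2 := congrArg (fun f => f.1 j) (hdown (wordVec k w (i + 1)))
          simp only [wordDown_wordVec hw, wordDown_apply, hw', if_true] at h2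
          rw [← h2] at h
          rcases ih j (by omega) (by omega) h with rfl | h3
          · exact .inl rfl
          · right
            simp only [wordRank, hw, hw']
            linarith

theorem wordSpace_diag_eq (hup : ∀ f, φ (wordUp k w f) = wordUp k w (φ f))
    (hdown : ∀ f, φ (wordDown k w f) = wordDown k w (φ f)) (i : ℕ) (hi : i ≤ w.length) :
    (φ (wordVec k w i)).1 i = (φ (wordVec k w 0)).1 0 := by
  induction i with
  | zero => rfl
  | succ i ih =>
    rw [← ih (by omega)]
    rcases getElem?_bool_cases (w := w) (i := i) (by omega) with hw | hw
    · rw [← wordUp_wordVec hw, hup, wordUp_succ, if_pos hw]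
    · have h2 := congrArg (fun f => f.1 i) (hdown (wordVec k w (i + 1)))
      simp only [wordDown_wordVec hw, wordDown_apply, hw, if_true] at h2
      exact h2.symm

theorem wordSpace_apply_eq_sum (ψ : wordSpace k w →ₗ[k] wordSpace k w) (f : wordSpace k w) (j : ℕ) :
    (ψ f).1 j = ∑ i ∈ Finset.range (w.length + 1), f.1 i * (ψ (wordVec k w i)).1 j := by
  conv_lhs => rw [← sum_smul_wordVec f]
  simp

theorem wordSpace_eq_zero_of_diag_eq_zero (hup : ∀ f, φ (wordUp k w f) = wordUp k w (φ f))
    (hdown : ∀ f, φ (wordDown k w f) = wordDown k w (φ f)) (hid : ∀ f, φ (φ f) = φ f)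
    (h0 : (φ (wordVec k w 0)).1 0 = 0) (f : wordSpace k w) : φ f = 0 := by
  classical
  suffices h : ∀ i ∈ Finset.range (w.length + 1), ∀ j, (φ (wordVec k w i)).1 j = 0 by
    ext j
    rw [wordSpace_apply_eq_sum]
    exact Finset.sum_eq_zero fun i hi => by rw [h i hi, mul_zero]
  by_contra! hne
  obtain ⟨i₀, hi₀, j, hj⟩ := hne
  have hjw : j ≤ w.length := by
    by_contra! hlt
    exact hj ((φ _).2 j hlt)
  -- An entry `(j, i)` with `i` of smallest rank factors through an entry of smaller rank.
  obtain ⟨i, hi, hmin⟩ := Finset.exists_min_image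
    ((Finset.range (w.length + 1)).filter fun i => (φ (wordVec k w i)).1 j ≠ 0) (wordRank w)
    ⟨i₀, Finset.mem_filter.2 ⟨hi₀, hj⟩⟩
  rw [Finset.mem_filter, Finset.mem_range] at hi
  have hsum := hi.2
  rw [← hid, wordSpace_apply_eq_sum] at hsum
  obtain ⟨l, hl, hne⟩ := Finset.exists_ne_zero_of_sum_ne_zero hsum
  have hl' := Finset.mem_range.1 hl
  rcases wordSpace_eq_or_rank_lt hup hdown i l (by omega) (by omega) (left_ne_zero_of_mul hne) with
    rfl | hlt
  · exact left_ne_zero_of_mul hne ((wordSpace_diag_eq hup hdown i (by omega)).trans h0)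
  · exact absurd (hmin l (Finset.mem_filter.2 ⟨hl, right_ne_zero_of_mul hne⟩)) (not_le.2 hlt)

/-- Word representations have no non-trivial idempotent endomorphisms. -/
theorem wordSpace_idempotent (hup : ∀ f, φ (wordUp k w f) = wordUp k w (φ f))
    (hdown : ∀ f, φ (wordDown k w f) = wordDown k w (φ f)) (hid : ∀ f, φ (φ f) = φ f) :
    φ = 0 ∨ φ = LinearMap.id := by
  have hsq : (φ (wordVec k w 0)).1 0 * (φ (wordVec k w 0)).1 0 = (φ (wordVec k w 0)).1 0 := by
    -- An off-diagonal summand would be a product of entries at mirrored positions, which require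
    -- opposite inequalities of ranks.
    conv_rhs => rw [← hid, wordSpace_apply_eq_sum]
    symm
    refine Finset.sum_eq_single 0 (fun l hl hne => ?_) (fun h => by simp at h)
    have hl' := Finset.mem_range.1 hl
    by_contra hn
    rcases wordSpace_eq_or_rank_lt hup hdown 0 l (by omega) (by omega) (left_ne_zero_of_mul hn) with
      h1 | h1
    · exact hne h1.symm
    · rcases wordSpace_eq_or_rank_lt hup hdown l 0 (by omega) (by omega)
          (right_ne_zero_of_mul hn) with h2 | h2
      · exact hne h2
      · exact lt_asymm h1 h2
  rcases IsIdempotentElem.iff_eq_zero_or_one.1 hsq with h0 | h1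
  · exact .inl (LinearMap.ext (wordSpace_eq_zero_of_diag_eq_zero hup hdown hid h0))
  · right
    have := wordSpace_eq_zero_of_diag_eq_zero (φ := LinearMap.id - φ) (by simp [hup])
      (by simp [hdown]) (by simp [hid]) (by simp [h1, wordVec_apply])
    exact LinearMap.ext fun f => (sub_eq_zero.1 (this f)).symm

end Endomorphisms

end Words

/-! ### Pairs of operators as modules over a square-zero extension -/

section Doubling

variable (k : Type u) [Field k]

/-- The commutative algebra `k[ε₀, ε₁, ε₂] / (ε₀, ε₁, ε₂)²`. -/
abbrev SquareZeroAlgebra : Type u := TrivSqZeroExt k (k × k × k)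

instance : FiniteDimensional k (SquareZeroAlgebra k) :=
  inferInstanceAs (Module.Finite k (k × (k × k × k)))

variable {k} {V W : Type u} [AddCommGroup V] [Module k V] [AddCommGroup W] [Module k W]

/-- The module `V × V` over `k[ε₀, ε₁, ε₂] / (ε₀, ε₁, ε₂)²` attached to two operators `X`, `Y` on
`V`: the elements `ε₀, ε₁, ε₂` map the first factor to the second by `id`, `X`, `Y` respectively,
and the second factor to zero. -/
@[nolint unusedArguments]
def DoubledModule (_X _Y : V →ₗ[k] V) : Type u := V × V

namespace DoubledModule

section Structure

variable (X Y : V →ₗ[k] V)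

instance : AddCommGroup (DoubledModule X Y) := inferInstanceAs (AddCommGroup (V × V))

instance : Module k (DoubledModule X Y) := inferInstanceAs (Module k (V × V))

instance [FiniteDimensional k V] : FiniteDimensional k (DoubledModule X Y) :=
  inferInstanceAs (FiniteDimensional k (V × V))

instance : SMul (SquareZeroAlgebra k) (DoubledModule X Y) where
  smul r m := (r.fst • m.1, r.fst • m.2 + (r.snd.1 • m.1 + r.snd.2.1 • X m.1 + r.snd.2.2 • Y m.1))

/-- The element of the doubled module with the given components. -/
def mk (v v' : V) : DoubledModule X Y := (v, v')

variable {X Y}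

@[simp] theorem mk_fst (v v' : V) : (mk X Y v v').1 = v := rfl
@[simp] theorem mk_snd (v v' : V) : (mk X Y v v').2 = v' := rfl
@[simp] theorem zero_fst : (0 : DoubledModule X Y).1 = 0 := rfl
@[simp] theorem zero_snd : (0 : DoubledModule X Y).2 = 0 := rfl
@[simp] theorem add_fst (m m' : DoubledModule X Y) : (m + m').1 = m.1 + m'.1 := rfl
@[simp] theorem add_snd (m m' : DoubledModule X Y) : (m + m').2 = m.2 + m'.2 := rfl
theorem sub_fst (m m' : DoubledModule X Y) : (m - m').1 = m.1 - m'.1 := rfl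
@[simp] theorem smul_fst' (c : k) (m : DoubledModule X Y) : (c • m).1 = c • m.1 := rfl
@[simp] theorem smul_snd' (c : k) (m : DoubledModule X Y) : (c • m).2 = c • m.2 := rfl

@[simp] theorem smul_fst (r : SquareZeroAlgebra k) (m : DoubledModule X Y) :
    (r • m).1 = r.fst • m.1 := rfl

@[simp] theorem smul_snd (r : SquareZeroAlgebra k) (m : DoubledModule X Y) : (r • m).2 =
    r.fst • m.2 + (r.snd.1 • m.1 + r.snd.2.1 • X m.1 + r.snd.2.2 • Y m.1) := rfl

@[ext] theorem ext {m m' : DoubledModule X Y} (h : m.1 = m'.1) (h' : m.2 = m'.2) : m = m' :=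
  Prod.ext h h'

instance : Module (SquareZeroAlgebra k) (DoubledModule X Y) where
  one_smul m := ext (by simp) (by simp)
  mul_smul r s m := ext (by simp [mul_smul]) (by
    simp only [smul_snd, smul_fst, TrivSqZeroExt.fst_mul, TrivSqZeroExt.snd_mul, Prod.fst_add,
      Prod.snd_add, Prod.smul_fst, Prod.smul_snd, smul_eq_mul, MulOpposite.smul_eq_mul_unop,
      MulOpposite.unop_op, map_smul]
    module)
  smul_zero r := ext (by simp) (by simp)
  smul_add r m m' := ext (by simp) (by simp; abel)
  add_smul r s m := ext (by simp [add_smul]) (by simp [add_smul]; abel)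
  zero_smul m := ext (by simp) (by simp)

instance : IsScalarTower k (SquareZeroAlgebra k) (DoubledModule X Y) where
  smul_assoc c r m := ext (by simp [mul_smul]) (by simp [mul_smul])

instance [FiniteDimensional k V] : Module.Finite (SquareZeroAlgebra k) (DoubledModule X Y) :=
  Module.Finite.of_restrictScalars_finite k _ _

end Structure

variable {X Y : V →ₗ[k] V} {X' Y' : W →ₗ[k] W}

/-- An intertwiner of two pairs of operators acts on both components of the doubled modules. -/
def map (P : V →ₗ[k] W) (hX : ∀ v, P (X v) = X' (P v)) (hY : ∀ v, P (Y v) = Y' (P v)) :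
    DoubledModule X Y →ₗ[SquareZeroAlgebra k] DoubledModule X' Y' where
  toFun m := mk X' Y' (P m.1) (P m.2)
  map_add' m m' := ext (by simp) (by simp)
  map_smul' r m := ext (by simp) (by simp [hX, hY])

variable (X Y X' Y') in
/-- Any linear map can be applied from the first component of one doubled module to the second
component of another, since the former is a quotient and the latter a submodule, both annihilated
by the `ε`'s. -/
def cross (P : V →ₗ[k] W) :
    DoubledModule X Y →ₗ[SquareZeroAlgebra k] DoubledModule X' Y' where
  toFun m := mk X' Y' 0 (P m.1)
  map_add' m m' := ext (by simp) (by simp)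
  map_smul' r m := ext (by simp) (by simp)

/-- The endomorphism of `V` induced by an endomorphism of the doubled module on its first
component. -/
def diag (φ : DoubledModule X Y →ₗ[SquareZeroAlgebra k] DoubledModule X Y) : V →ₗ[k] V where
  toFun v := (φ (mk X Y v 0)).1
  map_add' v v' := by
    rw [← add_fst, ← map_add]
    congr 2
    exact ext (by simp) (by simp)
  map_smul' c v := by
    rw [RingHom.id_apply, show mk X Y (c • v) 0 = (algebraMap k (SquareZeroAlgebra k) c) •
      mk X Y v 0 from ext (by simp) (by simp), map_smul]
    simp

variable (φ : DoubledModule X Y →ₗ[SquareZeroAlgebra k] DoubledModule X Y)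

theorem map_mk_zero_eq (c : k × k × k) (v : V) :
    φ (mk X Y 0 (c.1 • v + c.2.1 • X v + c.2.2 • Y v)) =
      mk X Y 0 (c.1 • diag φ v + c.2.1 • X (diag φ v) + c.2.2 • Y (diag φ v)) := by
  have h := map_smul φ (TrivSqZeroExt.inr c : SquareZeroAlgebra k) (mk X Y v 0)
  have e : (TrivSqZeroExt.inr c : SquareZeroAlgebra k) • mk X Y v 0 =
      mk X Y 0 (c.1 • v + c.2.1 • X v + c.2.2 • Y v) := ext (by simp) (by simp)
  rw [e] at h
  rw [h]
  exact ext (by simp) (by simp [diag])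

theorem map_mk_zero (v : V) : φ (mk X Y 0 v) = mk X Y 0 (diag φ v) := by
  simpa using map_mk_zero_eq φ (1, 0, 0) v

theorem diag_comm_fst (v : V) : diag φ (X v) = X (diag φ v) := by
  have h := map_mk_zero_eq φ (0, 1, 0) v
  simp only [zero_smul, one_smul, zero_add, add_zero, map_mk_zero] at h
  exact congrArg Prod.snd h

theorem diag_comm_snd (v : V) : diag φ (Y v) = Y (diag φ v) := by
  have h := map_mk_zero_eq φ (0, 0, 1) v
  simp only [zero_smul, one_smul, zero_add, map_mk_zero] at h
  exact congrArg Prod.snd h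

theorem apply_fst (m : DoubledModule X Y) : (φ m).1 = diag φ m.1 := by
  have e : m = mk X Y m.1 0 + mk X Y 0 m.2 := ext (by simp) (by simp)
  conv_lhs => rw [e, map_add, map_mk_zero]
  simp [diag]

theorem eq_zero_of_diag_eq_zero (hid : ∀ m, φ (φ m) = φ m) (h : diag φ = 0) : φ = 0 := by
  ext1 m
  -- `φ` maps everything to the second component and kills that component.
  have e : φ m = mk X Y 0 (φ m).2 := ext (by simp [apply_fst, h]) (by simp)
  rw [← hid, e, map_mk_zero, h]
  rfl

/-- If the only idempotent endomorphisms of `V` commuting with `X` and `Y` are trivial, then the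
same holds for the endomorphisms of the doubled module. -/
theorem idempotent_trivial
    (hV : ∀ p : V →ₗ[k] V, (∀ v, p (X v) = X (p v)) → (∀ v, p (Y v) = Y (p v)) →
      (∀ v, p (p v) = p v) → p = 0 ∨ p = LinearMap.id)
    (hid : ∀ m, φ (φ m) = φ m) : φ = 0 ∨ φ = LinearMap.id := by
  rcases hV (diag φ) (diag_comm_fst φ) (diag_comm_snd φ) (fun v => by
    have h := congrArg Prod.fst (hid (mk X Y v 0))
    simpa [apply_fst] using h) with h | h
  · exact .inl (eq_zero_of_diag_eq_zero φ hid h)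
  · right
    have h0 : LinearMap.id - φ = 0 := by
      refine eq_zero_of_diag_eq_zero _ (by simp [hid]) (LinearMap.ext fun v => ?_)
      have h1 : (φ (mk X Y v 0)).1 = v := by simp [apply_fst, h]
      change (mk X Y v 0 - φ (mk X Y v 0)).1 = 0
      rw [sub_fst, h1, mk_fst, sub_self]
    exact (sub_eq_zero.1 h0).symm

end DoubledModule

end Doubling

/-! ### A dense system of morphisms between word modules -/

/-- The words `w` and `v` agree in the first `p` letters, after which `w` ends or has the letter
`false`, `v` ends or has the letter `true`, and not both end. In the lexicographic order with
`false < end < true` this says that `w < v`, with `p` the length of the common initial segment. -/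
structure WordBranch (w v : List Bool) (p : ℕ) : Prop where
  le_left : p ≤ w.length
  le_right : p ≤ v.length
  agree : ∀ i < p, w[i]? = v[i]?
  left : w[p]? ≠ some true
  right : v[p]? ≠ some false
  ne : p < w.length ∨ p < v.length

/-- The order on words is dense, and the common initial segment is not shortened by inserting
a suitable word. -/
theorem WordBranch.exists_between {w v : List Bool} {p : ℕ} (h : WordBranch w v p) :
    ∃ s q r, WordBranch w s q ∧ WordBranch s v r ∧ min q r = p := by
  have hl := h.le_left
  have hr := h.le_right
  by_cases hw : p < w.length
  · have hget (i : ℕ) (hi : i < w.length) : (w ++ [true])[i]? = w[i]? :=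
      List.getElem?_append_left hi
    refine ⟨w ++ [true], w.length, p, ⟨le_rfl, by simp, fun i hi => (hget i hi).symm, by simp,
      by simp, by simp⟩, ⟨by simp; omega, hr, fun i hi => ?_, ?_, h.right, by simp; omega⟩,
      by omega⟩
    · rw [hget i (by omega), h.agree i hi]
    · rw [hget p hw]
      exact h.left
  · have hv : p < v.length := h.ne.resolve_left hw
    have hget (i : ℕ) (hi : i < v.length) : (v ++ [false])[i]? = v[i]? :=
      List.getElem?_append_left hi
    refine ⟨v ++ [false], p, v.length, ⟨hl, by simp; omega, fun i hi => ?_, h.left, ?_,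
      by simp; omega⟩, ⟨by simp, le_rfl, fun i hi => hget i hi, by simp, by simp, by simp⟩,
      by omega⟩
    · rw [hget i (by omega), h.agree i hi]
    · rw [hget p hv]
      exact h.right

section WordModules

variable (k : Type u) [Field k]

/-- The linear map sending the basis vectors `e_i`, `i ≤ p`, to the basis vectors of the same name,
and the other ones to zero. -/
def wordTrunc {w v : List Bool} {p : ℕ} (hp : p ≤ v.length) :
    wordSpace k w →ₗ[k] wordSpace k v where
  toFun f := ⟨fun j => if j ≤ p then f.1 j else 0, fun j hj => if_neg (by omega)⟩
  map_add' f g := by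
    ext j
    by_cases h : j ≤ p <;> simp [h]
  map_smul' c f := by
    ext j
    by_cases h : j ≤ p <;> simp [h]

variable {k}

theorem wordTrunc_apply {w v : List Bool} {p : ℕ} (hp : p ≤ v.length) (f : wordSpace k w) (j : ℕ) :
    (wordTrunc k hp f : wordSpace k v).1 j = if j ≤ p then f.1 j else 0 := rfl

theorem wordTrunc_wordUp {w v : List Bool} {p : ℕ} (h : WordBranch w v p) (f : wordSpace k w) :
    wordTrunc k h.le_right (wordUp k w f) = wordUp k v (wordTrunc k h.le_right f) := by
  ext (_ | j)
  · simp [wordTrunc_apply]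
  · simp only [wordTrunc_apply, wordUp_succ]
    rcases lt_trichotomy j p with hj | rfl | hj
    · rw [if_pos (by omega), if_pos hj.le, h.agree j hj]
    · rw [if_neg (by omega), if_neg h.right]
    · rw [if_neg (by omega), if_neg (by omega : ¬ j ≤ p), ite_self]

theorem wordTrunc_wordDown {w v : List Bool} {p : ℕ} (h : WordBranch w v p) (f : wordSpace k w) :
    wordTrunc k h.le_right (wordDown k w f) = wordDown k v (wordTrunc k h.le_right f) := by
  ext j
  simp only [wordTrunc_apply, wordDown_apply]
  rcases lt_trichotomy j p with hj | rfl | hj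
  · rw [if_pos hj.le, if_pos (by omega : j + 1 ≤ p), h.agree j hj]
  · rw [if_neg h.left, if_neg (by omega : ¬ j + 1 ≤ j), ite_self, ite_self]
  · rw [if_neg (by omega), if_neg (by omega : ¬ j + 1 ≤ p), ite_self]

variable (k)

/-- The finitely generated module over the square-zero algebra attached to a word. -/
abbrev wordModule (w : List Bool) : FGModuleCat.{u} (SquareZeroAlgebra k) :=
  FGModuleCat.of _ (DoubledModule (wordUp k w) (wordDown k w))

/-- The morphism of word modules given by truncation at the end of the common initial segment. -/
def wordHom {w v : List Bool} {p : ℕ} (h : WordBranch w v p) : wordModule k w ⟶ wordModule k v :=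
  FGModuleCat.ofHom (DoubledModule.map (wordTrunc k h.le_right) (wordTrunc_wordUp h)
    (wordTrunc_wordDown h))

theorem wordHom_comp {w s v : List Bool} {p q r : ℕ} (h : WordBranch w v p)
    (h₁ : WordBranch w s q) (h₂ : WordBranch s v r) (hp : min q r = p) :
    wordHom k h = wordHom k h₁ ≫ wordHom k h₂ := by
  have key (f : wordSpace k w) : wordTrunc k h.le_right f =
      wordTrunc k h₂.le_right (wordTrunc k h₁.le_right f : wordSpace k s) := by
    ext j
    simp only [wordTrunc_apply]
    by_cases h1 : j ≤ q <;> by_cases h2 : j ≤ r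
    · rw [if_pos (by omega), if_pos h2, if_pos h1]
    · rw [if_neg (by omega), if_neg h2]
    · rw [if_neg (by omega), if_pos h2, if_neg h1]
    · rw [if_neg (by omega), if_neg h2]
  exact FGModuleCat.hom_ext (LinearMap.ext fun m : DoubledModule (wordUp k w) (wordDown k w) =>
    DoubledModule.ext (X := wordUp k v) (Y := wordDown k v) (key m.1) (key m.2))

theorem wordVec_ne_zero {w : List Bool} {i : ℕ} (hi : i ≤ w.length) : wordVec k w i ≠ 0 := by
  intro h
  have h1 := congrArg (fun f => f.1 i) h
  simp [wordVec_apply, hi] at h1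

theorem wordModule_not_isZero (w : List Bool) : ¬ IsZero (wordModule k w) := by
  intro h
  rw [IsZero.iff_id_eq_zero] at h
  have h1 : DoubledModule.mk (wordUp k w) (wordDown k w) (wordVec k w 0) 0 = 0 :=
    congrArg (fun g : wordModule k w ⟶ wordModule k w =>
      g.hom.hom (DoubledModule.mk (wordUp k w) (wordDown k w) (wordVec k w 0) 0)) h
  exact wordVec_ne_zero k (Nat.zero_le _) (congrArg Prod.fst h1)

theorem wordModule_indecomposable (w : List Bool) : Indecomposable (wordModule k w) := by
  refine indecomposable_of_idempotents (wordModule_not_isZero k w) fun e he => ?_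
  have hid (m : DoubledModule (wordUp k w) (wordDown k w)) :
      e.hom.hom (e.hom.hom m) = e.hom.hom m := congrArg (fun g => g.hom.hom m) he
  rcases DoubledModule.idempotent_trivial e.hom.hom
    (fun p h1 h2 h3 => wordSpace_idempotent h1 h2 h3) hid with h | h
  · exact .inl (FGModuleCat.hom_ext h)
  · exact .inr (FGModuleCat.hom_ext h)

theorem wordHom_not_mono_and_epi {w v : List Bool} {p : ℕ} (h : WordBranch w v p) :
    ¬ (Mono (wordHom k h) ∧ Epi (wordHom k h)) := by
  rintro ⟨h1, h2⟩
  rcases h.ne with hlt | hlt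
  · have hz : (wordHom k h).hom.hom
        (DoubledModule.mk (wordUp k w) (wordDown k w) (wordVec k w (p + 1)) 0) = 0 := by
      refine DoubledModule.ext (X := wordUp k v) (Y := wordDown k v)
        (Subtype.ext (funext fun j => ?_)) (map_zero (wordTrunc k h.le_right))
      change (if j ≤ p then if j = p + 1 ∧ _ then (1 : k) else 0 else 0) = 0
      split_ifs <;> first | rfl | omega
    have h3 := (injective_iff_map_eq_zero _).1 (FGModuleCat.injective_of_mono' (wordHom k h)) _ hz
    exact wordVec_ne_zero k hlt (congrArg Prod.fst h3)
  · obtain ⟨m, hm⟩ := FGModuleCat.surjective_of_epi' (wordHom k h)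
      (DoubledModule.mk (wordUp k v) (wordDown k v) (wordVec k v (p + 1)) 0)
    have h3 : (wordTrunc k h.le_right m.1).1 (p + 1) = (wordVec k v (p + 1)).1 (p + 1) :=
      congrArg (fun f => f.1 (p + 1)) (congrArg Prod.fst hm)
    rw [wordTrunc_apply, wordVec_apply, if_neg (by omega), if_pos ⟨rfl, hlt⟩] at h3
    exact zero_ne_one h3

end WordModules

/-! ### Wild algebras -/

section Wild

variable (k : Type u) [Field k] {Λ : Type u} [Ring Λ]

/-- The images under a functor of the truncation morphisms between word modules. -/
inductive MappedWordHom (F : FGModuleCat.{u} (SquareZeroAlgebra k) ⥤ FGModuleCat.{u} Λ) :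
    MorphismProperty (FGModuleCat.{u} Λ)
  | intro {w v : List Bool} {p : ℕ} (h : WordBranch w v p) : MappedWordHom F (F.map (wordHom k h))

theorem map_wordHom_mem_transfiniteRadical
    {F : FGModuleCat.{u} (SquareZeroAlgebra k) ⥤ FGModuleCat.{u} Λ}
    (hF : IsRepresentationEmbedding F) {w v : List Bool} {p : ℕ} (h : WordBranch w v p) :
    F.map (wordHom k h) ∈ (transfiniteRadical (FGModuleCat.{u} Λ)).hom _ _ := by
  have := hF.faithful
  refine mem_transfiniteRadical_of_factors (S := MappedWordHom k F) ?_ ?_ _ (.intro h)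
  · rintro _ _ _ ⟨h⟩
    obtain ⟨s, q, r, h₁, h₂, hp⟩ := h.exists_between
    exact ⟨_, _, _, .intro h₁, .intro h₂, by rw [wordHom_comp k h h₁ h₂ hp, F.map_comp]⟩
  · rintro _ _ _ ⟨h⟩
    refine ⟨hF.indecomposable _ (wordModule_indecomposable k _),
      hF.indecomposable _ (wordModule_indecomposable k _), fun hiso => ?_⟩
    -- A faithful functor reflects monomorphisms and epimorphisms.
    exact wordHom_not_mono_and_epi k h
      ⟨F.mono_of_mono_map inferInstance, F.epi_of_epi_map inferInstance⟩

end Wild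

theorem mainTheorem7 (k : Type u) [Field k] [IsAlgClosed k]
    (Λ : Type u) [Ring Λ] [Algebra k Λ] [FiniteDimensional k Λ]
    (hΛ : IsWildAlgebra k Λ) :
    transfiniteRadical (FGModuleCat.{u} Λ) ≠ ⊥ ∧
      ∃ X : FGModuleCat.{u} Λ, Indecomposable X ∧
        (transfiniteRadical (FGModuleCat.{u} Λ)).hom X X ≠ ⊥ := by
  obtain ⟨F, hF⟩ := hΛ (SquareZeroAlgebra k)
  have := hF.faithful
  have := hF.additive
  have h : WordBranch [] [true] 0 := ⟨by simp, by simp, by simp, by simp, by simp, by simp⟩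
  -- The truncation followed by a map from the top of its target to the socle of its source.
  let g : wordModule k [true] ⟶ wordModule k [] :=
    FGModuleCat.ofHom (DoubledModule.cross _ _ _ _ (wordTrunc k (p := 0) (by simp)))
  have hmem : F.map (wordHom k h ≫ g) ∈
      (transfiniteRadical (FGModuleCat.{u} Λ)).hom (F.obj (wordModule k []))
        (F.obj (wordModule k [])) := by
    rw [F.map_comp]
    exact MorphismIdeal.comp_right _ _ (map_wordHom_mem_transfiniteRadical k hF h)
  have hne : F.map (wordHom k h ≫ g) ≠ 0 := by
    rw [Ne, F.map_eq_zero_iff]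
    intro h0
    have h1 := congrArg
      (fun t : wordModule k [] ⟶ wordModule k [] => (t.hom.hom
        (DoubledModule.mk (wordUp k []) (wordDown k []) (wordVec k [] 0) 0)).2.1 0) h0
    change (if 0 ≤ 0 then if 0 ≤ 0 then if 0 = 0 ∧ 0 ≤ 0 then (1 : k) else 0 else 0 else 0) = 0
      at h1
    simp at h1
  have hbot : (transfiniteRadical (FGModuleCat.{u} Λ)).hom (F.obj (wordModule k []))
      (F.obj (wordModule k [])) ≠ ⊥ := by
    intro hb
    rw [hb, AddSubgroup.mem_bot] at hmem
    exact hne hmem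
  refine ⟨fun hb => ?_, _, hF.indecomposable _ (wordModule_indecomposable k []), hbot⟩
  rw [hb] at hbot
  exact hbot rfl
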